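/- Let $\ell^1$ be the complex Banach space of absolutely summable sequences $\zeta=(\zeta_1,\zeta_2,\ldots)$ and $\mathbb{D}_1^\infty=\{\zeta\in\ell^1: |\zeta_j|<1 \text{ for all } j\}$. A function $F:\mathbb{D}_1^\infty\to\mathbb{C}$ is analytic if it is locally bounded and, for all $\zeta\in\mathbb{D}_1^\infty$ and $\eta\in\ell^1$, the function $z\mapsto F(\zeta+z\eta)$ is analytic on $\{z\in\mathbb{C}:\zeta+z\eta\in\mathbb{D}_1^\infty\}$. For $1\le p<\infty$ let $$\mathbf{H}_\infty^p=\Big\{F \text{ analytic on } \mathbb{D}_1^\infty:\ \sup_{0<r<1}\int_{\mathbb{T}^\infty}|F(rw_1,r^2w_2,r^3w_3,\ldots)|^p\,\mathrm{d}m_\infty(w)<\infty\Big\},$$ where $m_\infty=\frac{\mathrm{d}\theta_1}{2\pi}\times\frac{\mathrm{d}\theta_2}{2\pi}\times\cdots$ is the Haar measure of the infinite torus $\mathbb{T}^\infty$. For an integer $n\ge1$ with prime factorization $n=p_1^{\alpha_1}\cdots p_k^{\alpha_k}$ ($p_j$ the $j$-th prime) write $\zeta^{\alpha(n)}=\zeta_1^{\alpha_1}\cdots\zeta_k^{\alpha_k}$.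 Every analytic $F$ on $\mathbb{D}_1^\infty$ has a unique absolutely convergent monomial expansion $F(\zeta)=\sum_{n=1}^\infty a_n\zeta^{\alpha(n)}$, $\zeta\in\mathbb{D}_1^\infty$; through it, $\mathbf{H}_\infty^p$ is regarded as a space of complex sequences. A complex sequence $(\lambda_n)_{n\ge1}$ is a coefficient multiplier of $\mathbf{H}_\infty^2$ into $\mathbf{H}_\infty^p$ if $(\lambda_na_n)\in\mathbf{H}_\infty^p$ for every $(a_n)\in\mathbf{H}_\infty^2$. For a sequence $\boldsymbol{X}=(X_n)_{n\ge1}$ of real random variables and $F=\sum a_n\zeta^{\alpha(n)}$, the randomization of $F$ is the series $\mathcal{R}_{\boldsymbol{X}}F=\sum_{n=1}^\infty a_nX_n\zeta^{\alpha(n)}$; it belongs to $\mathbf{H}_\infty^p$ if it converges absolutely on $\mathbb{D}_1^\infty$ to a function in $\mathbf{H}_\infty^p$. **Proposition.** Let $1\le p<\infty$ and let $\boldsymbol{X}=(X_n)_{n\ge1}$ be a real Gaussian process (all finite-dimensional distributions are Gaussian, possibly degenerate; no independence is assumed) with $X_n\sim N(\mu_n,\sigma_n^2)$. Put $\boldsymbol{Y}=(X_n-\mu_n)_{n\ge1}$.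 The following are equivalent: 1. for every $F\in\mathbf{H}_\infty^2$, $\mathcal{R}_{\boldsymbol{X}}F\in\mathbf{H}_\infty^p$ almost surely; 2. $(\mu_n)_{n\ge1}$ is a coefficient multiplier of $\mathbf{H}_\infty^2$ into $\mathbf{H}_\infty^p$, and for every $F\in\mathbf{H}_\infty^2$, $\mathcal{R}_{\boldsymbol{Y}}F\in\mathbf{H}_\infty^p$ almost surely. -/

import Mathlib

open MeasureTheory ProbabilityTheory
open scoped ENNReal NNReal Topology

/-- The complex Banach space `ℓ¹` of absolutely summable sequences. The coordinate `ζ j`, `j : ℕ`,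
is the `(j + 1)`-st variable, usually written `ζ_{j+1}`. -/
abbrev EllOne : Type := lp (fun _ : ℕ => ℂ) 1

/-- The domain `𝔻^∞ ∩ ℓ¹` of `ℓ¹`. -/
def polydiskOne : Set EllOne := {ζ | ∀ j : ℕ, ‖ζ j‖ < 1}

/-- Analyticity on `𝔻^∞ ∩ ℓ¹`: local boundedness, and analyticity along complex lines. Only the
values of `F` on the domain matter. -/
structure IsAnalyticOnPolydisk (F : EllOne → ℂ) : Prop where
  locallyBounded : ∀ ζ ∈ polydiskOne, ∃ ε > 0, ∃ M : ℝ,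
    ∀ η ∈ polydiskOne, ‖η - ζ‖ < ε → ‖F η‖ ≤ M
  analyticOnLines : ∀ ζ ∈ polydiskOne, ∀ η : EllOne,
    AnalyticOnNhd ℂ (fun z : ℂ => F (ζ + z • η)) {z : ℂ | ζ + z • η ∈ polydiskOne}

instance fact_two_pi_pos : Fact (0 < 2 * Real.pi) := ⟨Real.two_pi_pos⟩

/-- The infinite torus `𝕋^∞`, a point being given by its sequence of angles modulo `2π`. -/
abbrev InfTorus : Type := ℕ → AddCircle (2 * Real.pi)

/-- The product measure `dθ₁/2π × dθ₂/2π × ⋯` on the infinite torus (its Haar measure). -/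
noncomputable def torusMeasure : Measure InfTorus :=
  Measure.infinitePi fun _ : ℕ => (AddCircle.haarAddCircle : Measure (AddCircle (2 * Real.pi)))

theorem memℓp_dilatedPoint (r : Set.Ioo (0 : ℝ) 1) (θ : InfTorus) :
    Memℓp (fun j : ℕ => ((r : ℝ) : ℂ) ^ (j + 1) * ((AddCircle.toCircle (θ j) : Circle) : ℂ)) 1 := by
  apply memℓp_gen
  have h : Summable fun j : ℕ => (r : ℝ) ^ (j + 1) :=
    (summable_nat_add_iff 1).2 (summable_geometric_of_lt_one r.2.1.le r.2.2)
  simpa [abs_of_pos r.2.1, Circle.norm_coe] using h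

/-- The point `(r w₁, r² w₂, r³ w₃, …)` of `𝔻^∞ ∩ ℓ¹`, where `w_j = exp(i θ_j)`. -/
noncomputable def dilatedPoint (r : Set.Ioo (0 : ℝ) 1) (θ : InfTorus) : EllOne :=
  ⟨fun j : ℕ => ((r : ℝ) : ℂ) ^ (j + 1) * ((AddCircle.toCircle (θ j) : Circle) : ℂ),
    memℓp_dilatedPoint r θ⟩

/-- The `p`-th power of the Hardy norm,
`‖F‖_p^p = sup_{0 < r < 1} ∫ |F(r w₁, r² w₂, …)|^p dm_∞(w)`, as an extended nonnegative number. -/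
noncomputable def hardyNormPow (p : ℝ) (F : EllOne → ℂ) : ℝ≥0∞ :=
  ⨆ r : Set.Ioo (0 : ℝ) 1, ∫⁻ θ, ‖F (dilatedPoint r θ)‖ₑ ^ p ∂torusMeasure

/-- The Hardy space of analytic functions on `𝔻^∞ ∩ ℓ¹` with finite Hardy norm. -/
def hardySpace (p : ℝ) : Set (EllOne → ℂ) :=
  {F | IsAnalyticOnPolydisk F ∧ hardyNormPow p F < ⊤}

/-- The monomial `ζ^{α(n)} = ζ₁^{α₁} ⋯ ζ_k^{α_k}`, where `n = p₁^{α₁} ⋯ p_k^{α_k}` is the prime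
factorization of `n` and `p_j` is the `j`-th prime. As `Nat.primeCounting' q` is the number of
primes less than `q`, it is the zero-based position of the prime `q`. -/
noncomputable def primeMonomial (ζ : EllOne) (n : ℕ+) : ℂ :=
  (n : ℕ).factorization.prod fun q k => ζ (Nat.primeCounting' q) ^ k

/-- `F(ζ) = ∑_{n ≥ 1} a_n ζ^{α(n)}` for all `ζ ∈ 𝔻^∞ ∩ ℓ¹`, the series converging absolutely. -/
def HasMonomialExpansion (F : EllOne → ℂ) (a : ℕ+ → ℂ) : Prop :=
  ∀ ζ ∈ polydiskOne, HasSum (fun n : ℕ+ => a n * primeMonomial ζ n) (F ζ)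

/-- The Hardy space regarded as a space of complex sequences, through monomial expansions. Thus
`a ∈ hardySequences p` says that the series `∑ a_n ζ^{α(n)}` converges absolutely on `𝔻^∞ ∩ ℓ¹`
to a function of the Hardy space. -/
def hardySequences (p : ℝ) : Set (ℕ+ → ℂ) :=
  {a | ∃ F ∈ hardySpace p, HasMonomialExpansion F a}

/-- The coefficient multipliers of a sequence space `S` into a sequence space `T`. -/
def coefficientMultipliers (S T : Set (ℕ+ → ℂ)) : Set (ℕ+ → ℂ) :=
  {l | ∀ x ∈ S, (fun n => l n * x n) ∈ T}

/-- For every `F ∈ H²_∞` with monomial expansion `∑ a_n ζ^{α(n)}`, the randomization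
`∑ a_n X_n ζ^{α(n)}` belongs to `H^p_∞` almost surely. -/
def RandomizationMapsInto {Ω : Type*} [MeasurableSpace Ω] (P : Measure Ω)
    (X : ℕ+ → Ω → ℝ) (p : ℝ) : Prop :=
  ∀ F ∈ hardySpace 2, ∀ a : ℕ+ → ℂ, HasMonomialExpansion F a →
    ∀ᵐ ω ∂P, (fun n => a n * (X n ω : ℂ)) ∈ hardySequences p

/-! A Gaussian process `X` and its reflection `2μ - X` have the same law. If `(a_n X_n)` lies in
`hardySequences p` almost surely, so does `(a_n (2μ_n - X_n))`; at an outcome where both hold, half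
their sum is `(μ_n a_n)`. So `μ` is a multiplier, and everything else follows because
`hardySequences p` is a vector space.

Transferring an almost sure statement between equal laws requires `hardySequences p` to be
measurable in the product space, and most of the proof goes into this. Cauchy's formula
(`coeff_eq_integral`, `norm_coeff_le`) shows that its elements are bounded. Conversely, an Euler
product bound (`sum_seqMonomial_le`) makes every series with bounded coefficients absolutely
convergent and analytic. Membership thus means boundedness and a finite Hardy norm
(`mem_hardySequences_iff`), and Fatou's lemma reduces the supremum over radii to a countable one. -/

/-- The monomial `∏ x_{j(q)} ^ {v_q(n)}` over the primes `q`, where `j(q)` is the position of `q`. -/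
noncomputable def seqMonomial {R : Type*} [CommMonoid R] (x : ℕ → R) (n : ℕ) : R :=
  n.factorization.prod fun q k => x (Nat.primeCounting' q) ^ k

theorem primeMonomial_eq_seqMonomial (ζ : EllOne) (n : ℕ+) :
    primeMonomial ζ n = seqMonomial (fun j => ζ j) n := rfl

/-! ### Multiplicativity of monomials -/

section SeqMonomial

variable {R : Type*} [CommMonoid R]

theorem seqMonomial_one (x : ℕ → R) : seqMonomial x 1 = 1 := by
  simp [seqMonomial]

theorem seqMonomial_mul_index (x : ℕ → R) {m n : ℕ} (hm : m ≠ 0) (hn : n ≠ 0) :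
    seqMonomial x (m * n) = seqMonomial x m * seqMonomial x n := by
  unfold seqMonomial
  rw [Nat.factorization_mul hm hn]
  exact Finsupp.prod_add_index' (by simp) (by intros; exact pow_add _ _ _)

theorem seqMonomial_prime (x : ℕ → R) {p : ℕ} (hp : p.Prime) :
    seqMonomial x p = x (Nat.primeCounting' p) := by
  simp [seqMonomial, hp.factorization]

theorem seqMonomial_mul (x y : ℕ → R) (n : ℕ) :
    seqMonomial (fun j => x j * y j) n = seqMonomial x n * seqMonomial y n := by
  simp [seqMonomial, mul_pow]

theorem map_seqMonomial {S : Type*} [CommMonoid S] (f : R →* S) (x : ℕ → R) (n : ℕ) :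
    f (seqMonomial x n) = seqMonomial (fun j => f (x j)) n := by
  simp [seqMonomial, Finsupp.prod, map_prod]

end SeqMonomial

theorem norm_seqMonomial (x : ℕ → ℂ) (n : ℕ) :
    ‖seqMonomial x n‖ = seqMonomial (fun j => ‖x j‖) n :=
  map_seqMonomial (normHom : ℂ →*₀ ℝ).toMonoidHom x n

theorem seqMonomial_nonneg {x : ℕ → ℝ} (hx : ∀ j, 0 ≤ x j) (n : ℕ) : 0 ≤ seqMonomial x n := by
  unfold seqMonomial Finsupp.prod
  exact Finset.prod_nonneg fun _ _ => pow_nonneg (hx _) _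

theorem seqMonomial_mono {x y : ℕ → ℝ} (hx : ∀ j, 0 ≤ x j) (hxy : ∀ j, x j ≤ y j) (n : ℕ) :
    seqMonomial x n ≤ seqMonomial y n := by
  unfold seqMonomial Finsupp.prod
  exact Finset.prod_le_prod (fun _ _ => pow_nonneg (hx _) _)
    fun _ _ => pow_le_pow_left₀ (hx _) (hxy _) _

/-! ### Absolute convergence through Euler products -/

theorem inv_one_sub_le_exp {t q : ℝ} (h0 : 0 ≤ t) (htq : t ≤ q) (hq : q < 1) :
    (1 - t)⁻¹ ≤ Real.exp (t / (1 - q)) := by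
  have h1 : (1 - t)⁻¹ = t / (1 - t) + 1 := by
    have : 1 - t ≠ 0 := by linarith
    field_simp
    ring
  calc (1 - t)⁻¹ = t / (1 - t) + 1 := h1
    _ ≤ t / (1 - q) + 1 := by
        have : t / (1 - t) ≤ t / (1 - q) :=
          div_le_div_of_nonneg_left h0 (by linarith) (by linarith)
        linarith
    _ ≤ _ := Real.add_one_le_exp _

/-- Any finite set of indices consists of `N`-smooth numbers for some `N`, and the sum over those is
the Euler product of the factors `(1 - x_j)⁻¹ ≤ exp (x_j / (1 - q))`. The bound depends only on `q`
and the `ℓ¹` norm, which later gives local boundedness. -/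
theorem sum_seqMonomial_le {x : ℕ → ℝ} {q : ℝ} (h0 : ∀ j, 0 ≤ x j) (hxq : ∀ j, x j ≤ q)
    (hq : q < 1) (hx : Summable x) (s : Finset ℕ+) :
    ∑ n ∈ s, seqMonomial x n ≤ Real.exp ((∑' j, x j) / (1 - q)) := by
  -- `seqMonomial x 0 = 1` would break multiplicativity at `0`, so the value there is reset to `0`.
  let f : ℕ →* ℝ :=
    { toFun n := if n = 0 then 0 else seqMonomial x n
      map_one' := by simp [seqMonomial_one]
      map_mul' m n := by
        by_cases hm : m = 0
        · simp [hm]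
        by_cases hn : n = 0
        · simp [hn]
        simp [hm, hn, seqMonomial_mul_index x hm hn] }
  have hf (n : ℕ) : f n = if n = 0 then 0 else seqMonomial x n := rfl
  have hf0 (n : ℕ) : 0 ≤ f n := by
    rw [hf]; split_ifs
    · exact le_rfl
    · exact seqMonomial_nonneg h0 n
  have hfp {p : ℕ} (hp : p.Prime) : f p = x (Nat.primeCounting' p) := by
    rw [hf, if_neg hp.ne_zero, seqMonomial_prime x hp]
  obtain ⟨N, hN⟩ : ∃ N : ℕ, ∀ n ∈ s, (n : ℕ) < N := by
    refine ⟨s.sup (fun n : ℕ+ => (n : ℕ)) + 1, fun n hn => Nat.lt_succ_of_le ?_⟩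
    exact Finset.le_sup (f := fun n : ℕ+ => (n : ℕ)) hn
  have hsum := (EulerProduct.summable_and_hasSum_smoothNumbers_prod_primesBelow_geometric (f := f)
    (fun {p} hp => by
      rw [hfp hp, Real.norm_of_nonneg (h0 _)]
      exact (hxq _).trans_lt hq) N).2
  have hsum' := (hasSum_subtype_iff_indicator (f := fun n => f n)).1 hsum
  have h1 : ∑ n ∈ s, seqMonomial x n ≤ ∏ p ∈ N.primesBelow, (1 - f p)⁻¹ := by
    refine le_trans (le_of_eq ?_) (sum_le_hasSum (s.map ⟨_, PNat.coe_injective⟩)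
      (fun i _ => Set.indicator_nonneg (fun n _ => hf0 n) i) hsum')
    rw [Finset.sum_map]
    refine Finset.sum_congr rfl fun n hn => ?_
    rw [Function.Embedding.coeFn_mk, Set.indicator_of_mem
      (Nat.mem_smoothNumbers_of_lt n.pos (hN n hn)), hf, if_neg n.ne_zero]
  refine h1.trans ?_
  have h2 : ∑ p ∈ N.primesBelow, x (Nat.primeCounting' p) ≤ ∑' j, x j := by
    rw [← Finset.sum_image (f := x) (g := Nat.primeCounting')]
    · exact hx.sum_le_tsum _ fun i _ => h0 i
    · intro a ha b hb hab
      exact Nat.count_injective (Nat.prime_of_mem_primesBelow ha)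
        (Nat.prime_of_mem_primesBelow hb) hab
  calc ∏ p ∈ N.primesBelow, (1 - f p)⁻¹
      ≤ ∏ p ∈ N.primesBelow, Real.exp (x (Nat.primeCounting' p) / (1 - q)) := by
        refine Finset.prod_le_prod (fun p hp => ?_) fun p hp => ?_ <;>
          rw [hfp (Nat.prime_of_mem_primesBelow hp)]
        · exact inv_nonneg.2 (by linarith [hxq (Nat.primeCounting' p)])
        · exact inv_one_sub_le_exp (h0 _) (hxq _) hq
    _ = Real.exp ((∑ p ∈ N.primesBelow, x (Nat.primeCounting' p)) / (1 - q)) := by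
        rw [← Real.exp_sum, Finset.sum_div]
    _ ≤ _ := by
        gcongr

/-- Only finitely many terms are at least `1 / 2`, and these have a maximum. -/
theorem exists_lt_one_forall_le {x : ℕ → ℝ} (hx : Summable x) (h1 : ∀ j, x j < 1) :
    ∃ q < 1, ∀ j, x j ≤ q := by
  have hfin : {j | ¬ x j < 1 / 2}.Finite :=
    (hx.tendsto_cofinite_zero.eventually (gt_mem_nhds (by norm_num : (0 : ℝ) < 1 / 2)))
  rcases Set.eq_empty_or_nonempty {j | ¬ x j < 1 / 2} with he | hne
  · refine ⟨1 / 2, by norm_num, fun j => ?_⟩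
    by_contra hj
    have : j ∈ {j | ¬ x j < 1 / 2} := fun h => hj h.le
    rw [he] at this
    exact this
  · obtain ⟨j₀, -, hj₀⟩ := Set.exists_max_image _ x hfin hne
    refine ⟨max (1 / 2) (x j₀), max_lt (by norm_num) (h1 _), fun j => ?_⟩
    by_cases hj : x j < 1 / 2
    · exact hj.le.trans (le_max_left _ _)
    · exact (hj₀ j hj).trans (le_max_right _ _)

theorem summable_seqMonomial {x : ℕ → ℝ} (h0 : ∀ j, 0 ≤ x j) (h1 : ∀ j, x j < 1)
    (hx : Summable x) : Summable fun n : ℕ+ => seqMonomial x n := by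
  obtain ⟨q, hq, hxq⟩ := exists_lt_one_forall_le hx h1
  exact summable_of_sum_le (fun n => seqMonomial_nonneg h0 n) (sum_seqMonomial_le h0 hxq hq hx)

theorem summable_norm_coord (ζ : EllOne) : Summable fun j => ‖ζ j‖ := by
  simpa using (lp.memℓp ζ).summable (by simp)

theorem norm_eq_tsum_norm_coord (ζ : EllOne) : ‖ζ‖ = ∑' j, ‖ζ j‖ := by
  simpa using lp.norm_eq_tsum_rpow (by simp) ζ

theorem norm_primeMonomial (ζ : EllOne) (n : ℕ+) :
    ‖primeMonomial ζ n‖ = seqMonomial (fun j => ‖ζ j‖) n :=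
  norm_seqMonomial _ _

theorem summable_norm_primeMonomial {ζ : EllOne} (hζ : ζ ∈ polydiskOne) :
    Summable fun n : ℕ+ => ‖primeMonomial ζ n‖ := by
  simp_rw [norm_primeMonomial]
  exact summable_seqMonomial (fun _ => norm_nonneg _) hζ (summable_norm_coord ζ)

theorem norm_mul_primeMonomial_le {b : ℕ+ → ℂ} {C : ℝ} (hb : ∀ n, ‖b n‖ ≤ C) (ζ : EllOne) (n : ℕ+) :
    ‖b n * primeMonomial ζ n‖ ≤ C * ‖primeMonomial ζ n‖ := by
  rw [norm_mul]
  exact mul_le_mul_of_nonneg_right (hb n) (norm_nonneg _)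

theorem summable_mul_primeMonomial {b : ℕ+ → ℂ} {C : ℝ} (hb : ∀ n, ‖b n‖ ≤ C) {ζ : EllOne}
    (hζ : ζ ∈ polydiskOne) : Summable fun n => b n * primeMonomial ζ n :=
  ((summable_norm_primeMonomial hζ).mul_left C).of_norm_bounded (norm_mul_primeMonomial_le hb ζ)

/-! ### Analyticity of series with bounded coefficients -/

/-- A point of the polydisk has a neighbourhood on which the coordinates stay away from the unit
circle. -/
theorem exists_ball_coord_le {ζ : EllOne} (hζ : ζ ∈ polydiskOne) :
    ∃ ε > 0, ∃ q < 1, ∀ η : EllOne, ‖η - ζ‖ < ε → ∀ j, ‖η j‖ ≤ q := by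
  obtain ⟨q, hq, hζq⟩ := exists_lt_one_forall_le (summable_norm_coord ζ) hζ
  refine ⟨(1 - q) / 2, by linarith, (1 + q) / 2, by linarith, fun η hη j => ?_⟩
  have h1 : ‖η j - ζ j‖ ≤ ‖η - ζ‖ := lp.norm_apply_le_norm one_ne_zero (η - ζ) j
  have h2 : ‖η j‖ ≤ ‖η j - ζ j‖ + ‖ζ j‖ := by simpa using norm_add_le (η j - ζ j) (ζ j)
  linarith [hζq j]

theorem differentiable_primeMonomial_line (ζ η : EllOne) (n : ℕ+) :
    Differentiable ℂ fun z : ℂ => primeMonomial (ζ + z • η) n := by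
  unfold primeMonomial Finsupp.prod
  simp only [lp.coeFn_add, lp.coeFn_smul, Pi.add_apply, Pi.smul_apply, smul_eq_mul]
  fun_prop

/-- A power series with bounded coefficients is analytic on `𝔻^∞ ∩ ℓ¹`. -/
theorem isAnalyticOnPolydisk_of_bounded {F : EllOne → ℂ} {b : ℕ+ → ℂ} {C : ℝ}
    (hb : ∀ n, ‖b n‖ ≤ C) (hF : HasMonomialExpansion F b) : IsAnalyticOnPolydisk F where
  locallyBounded ζ hζ := by
    obtain ⟨ε, hε, q, hq, h⟩ := exists_ball_coord_le hζ
    have hC : 0 ≤ C := (norm_nonneg _).trans (hb 1)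
    refine ⟨ε, hε, C * Real.exp ((‖ζ‖ + ε) / (1 - q)), fun η hη hηζ => ?_⟩
    rw [← (hF η hη).tsum_eq]
    have hs := summable_norm_primeMonomial hη
    refine (tsum_of_norm_bounded (hs.mul_left C).hasSum (norm_mul_primeMonomial_le hb η)).trans ?_
    rw [tsum_mul_left]
    refine mul_le_mul_of_nonneg_left (hs.tsum_le_of_sum_le fun s => ?_) hC
    simp_rw [norm_primeMonomial]
    refine (sum_seqMonomial_le (fun _ => norm_nonneg _) (h η hηζ) hq
      (summable_norm_coord η) s).trans ?_
    rw [← norm_eq_tsum_norm_coord]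
    have : ‖η‖ ≤ ‖ζ‖ + ε := by
      have : ‖η‖ ≤ ‖η - ζ‖ + ‖ζ‖ := by simpa using norm_add_le (η - ζ) ζ
      linarith
    gcongr
  analyticOnLines ζ hζ η z₀ hz₀ := by
    have hz₀' : ζ + z₀ • η ∈ polydiskOne := hz₀
    obtain ⟨q, hq, hq'⟩ := exists_lt_one_forall_le (summable_norm_coord _) hz₀'
    -- For `|z - z₀| < δ` each coordinate moves by at most `(1 - q) / 2`, so the majorant `x` below
    -- stays under `1` and the Weierstrass M-test applies.
    set δ : ℝ := (1 - q) / (2 * (‖η‖ + 1)) with hδ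
    have hη1 : 0 < ‖η‖ + 1 := by positivity
    have hδ0 : 0 < δ := div_pos (by linarith) (by positivity)
    have hδη : δ * ‖η‖ ≤ (1 - q) / 2 := by
      rw [hδ, div_mul_eq_mul_div, div_le_div_iff₀ (by positivity) (by norm_num)]
      nlinarith [norm_nonneg η]
    set x : ℕ → ℝ := fun j => ‖(ζ + z₀ • η) j‖ + δ * ‖η j‖ with hx
    have hx0 (j : ℕ) : 0 ≤ x j := by positivity
    have hx1 (j : ℕ) : x j < 1 := by
      have : ‖η j‖ ≤ ‖η‖ := lp.norm_apply_le_norm one_ne_zero η j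
      have : δ * ‖η j‖ ≤ δ * ‖η‖ := mul_le_mul_of_nonneg_left this hδ0.le
      have := hq' j
      simp only [hx]
      linarith
    have hxs : Summable x :=
      (summable_norm_coord _).add ((summable_norm_coord η).mul_left δ)
    have hxb {z : ℂ} (hz : z ∈ Metric.ball z₀ δ) (j : ℕ) : ‖(ζ + z • η) j‖ ≤ x j := by
      have h1 : (ζ + z • η) j = (ζ + z₀ • η) j + (z - z₀) * η j := by
        simp only [lp.coeFn_add, lp.coeFn_smul, Pi.add_apply, Pi.smul_apply, smul_eq_mul]
        ring
      rw [h1]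
      refine (norm_add_le _ _).trans (add_le_add_right ?_ _)
      rw [norm_mul]
      refine mul_le_mul_of_nonneg_right ?_ (norm_nonneg _)
      rw [← dist_eq_norm]
      exact (Metric.mem_ball.1 hz).le
    have hd : DifferentiableOn ℂ (fun z : ℂ => ∑' n : ℕ+, b n * primeMonomial (ζ + z • η) n)
        (Metric.ball z₀ δ) := by
      refine Complex.differentiableOn_tsum_of_summable_norm
        ((summable_seqMonomial hx0 hx1 hxs).mul_left C)
        (fun n => ((differentiable_primeMonomial_line ζ η n).const_mul _).differentiableOn)
        Metric.isOpen_ball fun n z hz => ?_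
      refine (norm_mul_primeMonomial_le hb _ n).trans ?_
      rw [norm_primeMonomial]
      exact mul_le_mul_of_nonneg_left (seqMonomial_mono (fun _ => norm_nonneg _) (hxb hz) n)
        ((norm_nonneg _).trans (hb 1))
    refine (hd.analyticAt (Metric.ball_mem_nhds z₀ hδ0)).congr ?_
    filter_upwards [Metric.ball_mem_nhds z₀ hδ0] with z hz
    exact (hF _ fun j => (hxb hz j).trans_lt (hx1 j)).tsum_eq

/-! ### Torus characters and Cauchy's formula -/

theorem dilatedPoint_apply (r : Set.Ioo (0 : ℝ) 1) (θ : InfTorus) (j : ℕ) :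
    dilatedPoint r θ j = ((r : ℝ) : ℂ) ^ (j + 1) * ((AddCircle.toCircle (θ j) : Circle) : ℂ) := rfl

theorem norm_dilatedPoint_apply (r : Set.Ioo (0 : ℝ) 1) (θ : InfTorus) (j : ℕ) :
    ‖dilatedPoint r θ j‖ = (r : ℝ) ^ (j + 1) := by
  rw [dilatedPoint_apply, norm_mul, Circle.norm_coe, mul_one, norm_pow, Complex.norm_real,
    Real.norm_of_nonneg r.2.1.le]

theorem dilatedPoint_mem (r : Set.Ioo (0 : ℝ) 1) (θ : InfTorus) :
    dilatedPoint r θ ∈ polydiskOne := fun j => by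
  rw [norm_dilatedPoint_apply]
  exact pow_lt_one₀ r.2.1.le r.2.2 j.succ_ne_zero

/-- The character `w ↦ w^{α(n)}` of the infinite torus. -/
noncomputable def torusChar (n : ℕ) (θ : InfTorus) : Circle :=
  seqMonomial (fun j => AddCircle.toCircle (θ j)) n

theorem torusChar_add (n : ℕ) (θ c : InfTorus) :
    torusChar n (θ + c) = torusChar n θ * torusChar n c := by
  simp only [torusChar, Pi.add_apply, AddCircle.toCircle_add]
  exact seqMonomial_mul _ _ n

@[fun_prop]
theorem continuous_torusChar (n : ℕ) : Continuous (torusChar n) := by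
  unfold torusChar seqMonomial Finsupp.prod
  refine continuous_finsetProd _ fun q _ => Continuous.pow ?_ _
  exact AddCircle.continuous_toCircle.comp (continuous_apply _)

theorem torusChar_single (n p : ℕ) (hp : p.Prime) (t : AddCircle (2 * Real.pi)) :
    torusChar n (Pi.single (Nat.primeCounting' p) t) =
      AddCircle.toCircle t ^ n.factorization p := by
  unfold torusChar seqMonomial
  rw [Finsupp.prod_eq_single p]
  · simp
  · intro q hq hqp
    have hq' : q.Prime := by
      by_contra h
      exact hq (Nat.factorization_eq_zero_of_not_prime n h)
    have : Nat.primeCounting' q ≠ Nat.primeCounting' p := fun h => hqp (Nat.count_injective hq' hp h)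
    simp [Pi.single_eq_of_ne this]
  · simp

theorem primeMonomial_dilatedPoint (r : Set.Ioo (0 : ℝ) 1) (θ : InfTorus) (n : ℕ+) :
    primeMonomial (dilatedPoint r θ) n =
      ((seqMonomial (fun j => (r : ℝ) ^ (j + 1)) n : ℝ) : ℂ) * (torusChar n θ : ℂ) := by
  rw [primeMonomial_eq_seqMonomial]
  simp only [dilatedPoint_apply]
  rw [seqMonomial_mul]
  congr 1
  · exact_mod_cast (map_seqMonomial Complex.ofRealHom.toMonoidHom
      (fun j => (r : ℝ) ^ (j + 1)) (n : ℕ)).symm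
  · exact (map_seqMonomial Circle.coeHom (fun j => AddCircle.toCircle (θ j)) (n : ℕ)).symm

theorem norm_primeMonomial_dilatedPoint (r : Set.Ioo (0 : ℝ) 1) (θ : InfTorus) (n : ℕ+) :
    ‖primeMonomial (dilatedPoint r θ) n‖ = seqMonomial (fun j => (r : ℝ) ^ (j + 1)) n := by
  rw [norm_primeMonomial]
  simp only [norm_dilatedPoint_apply]

theorem continuous_primeMonomial_dilatedPoint (r : Set.Ioo (0 : ℝ) 1) (n : ℕ+) :
    Continuous fun θ => primeMonomial (dilatedPoint r θ) n := by
  simp only [primeMonomial_dilatedPoint]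
  fun_prop

instance : IsProbabilityMeasure torusMeasure := by
  unfold torusMeasure; infer_instance

instance : torusMeasure.IsAddRightInvariant where
  map_add_right_eq_self c := by
    have h := Measure.infinitePi_map_pi
      (fun _ : ℕ => (AddCircle.haarAddCircle : Measure (AddCircle (2 * Real.pi))))
      (f := fun i x => x + c i) (fun i => by fun_prop)
    simp only [map_add_right_eq_self] at h
    exact h

/-- At a prime where the exponents differ by `k ≠ 0`, rotate that coordinate alone by `π / k`: the
two values then differ by the factor `exp(iπ) = -1`. -/
theorem exists_torusChar_ne {m n : ℕ} (hm : m ≠ 0) (hn : n ≠ 0) (hmn : m ≠ n) :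
    ∃ c, torusChar n c ≠ torusChar m c := by
  obtain ⟨p, hp⟩ : ∃ p, n.factorization p ≠ m.factorization p := by
    by_contra! h
    exact hmn (Nat.eq_of_factorization_eq hm hn fun p => (h p).symm)
  have hpp : p.Prime := by
    by_contra h
    simp [Nat.factorization_eq_zero_of_not_prime _ h] at hp
  set k : ℤ := n.factorization p - m.factorization p with hk
  have hk0 : k ≠ 0 := sub_ne_zero.2 (by exact_mod_cast hp)
  set t : AddCircle (2 * Real.pi) := ((2 * Real.pi / 2 / k : ℝ) : AddCircle (2 * Real.pi))
  refine ⟨Pi.single (Nat.primeCounting' p) t, fun h => ?_⟩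
  rw [torusChar_single _ _ hpp, torusChar_single _ _ hpp] at h
  have h1 : (AddCircle.toCircle t) ^ k = 1 := by
    rw [hk, zpow_sub, zpow_natCast, zpow_natCast, h, mul_inv_cancel]
  have h2 := fourier_add_half_inv_index hk0 Real.two_pi_pos (0 : AddCircle (2 * Real.pi))
  rw [zero_add, fourier_apply, AddCircle.toCircle_zsmul, h1] at h2
  norm_num [fourier_apply] at h2

/-- Translation by a `c` separating the characters multiplies the integral by a number other than
`1`, yet leaves it invariant. -/
theorem integral_torusChar_mul_conj {m n : ℕ} (hm : m ≠ 0) (hn : n ≠ 0) (hmn : m ≠ n) :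
    ∫ θ, (torusChar n θ : ℂ) * ((torusChar m θ)⁻¹ : Circle) ∂torusMeasure = 0 := by
  obtain ⟨c, hc⟩ := exists_torusChar_ne hm hn hmn
  have h := integral_add_right_eq_self (μ := torusMeasure)
    (fun θ => (torusChar n θ : ℂ) * ((torusChar m θ)⁻¹ : Circle)) c
  have h1 (θ : InfTorus) : (torusChar n (θ + c) : ℂ) * ((torusChar m (θ + c))⁻¹ : Circle) =
      (torusChar n c / torusChar m c : Circle) *
        ((torusChar n θ : ℂ) * ((torusChar m θ)⁻¹ : Circle)) := by
    rw [torusChar_add, torusChar_add]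
    simp only [Circle.coe_mul, Circle.coe_inv, Circle.coe_div, mul_inv]
    ring
  simp only [h1] at h
  rw [integral_const_mul] at h
  by_contra h0
  have h2 := mul_right_cancel₀ h0 (h.trans (one_mul _).symm)
  exact hc (div_eq_one.1 (Circle.coe_eq_one.1 h2))

/-- Cauchy's formula for the coefficients. -/
theorem coeff_eq_integral {F : EllOne → ℂ} {b : ℕ+ → ℂ} (hF : HasMonomialExpansion F b)
    (r : Set.Ioo (0 : ℝ) 1) (m : ℕ+) :
    ∫ θ, F (dilatedPoint r θ) * ((torusChar m θ)⁻¹ : Circle) ∂torusMeasure =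
      b m * (seqMonomial (fun j => (r : ℝ) ^ (j + 1)) m : ℝ) := by
  have hnorm (n : ℕ+) (θ : InfTorus) :
      ‖b n * primeMonomial (dilatedPoint r θ) n * ((torusChar m θ)⁻¹ : Circle)‖ =
        ‖b n * primeMonomial (dilatedPoint r 0) n‖ := by
    rw [norm_mul, Circle.norm_coe, mul_one, norm_mul, norm_mul, norm_primeMonomial_dilatedPoint,
      norm_primeMonomial_dilatedPoint]
  have hcont (n : ℕ+) : Continuous fun θ =>
      b n * primeMonomial (dilatedPoint r θ) n * ((torusChar m θ)⁻¹ : Circle) :=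
    (continuous_const.mul (continuous_primeMonomial_dilatedPoint r n)).mul (by fun_prop)
  have hint (n : ℕ+) : Integrable (fun θ =>
      b n * primeMonomial (dilatedPoint r θ) n * ((torusChar m θ)⁻¹ : Circle)) torusMeasure :=
    Integrable.of_bound (hcont n).aestronglyMeasurable _ (.of_forall fun θ => (hnorm n θ).le)
  have hsum := integral_tsum_of_summable_integral_norm hint (by
    simp only [hnorm, integral_const, probReal_univ, one_smul]
    exact (hF _ (dilatedPoint_mem r 0)).summable.norm)
  have hF' (θ : InfTorus) : F (dilatedPoint r θ) * ((torusChar m θ)⁻¹ : Circle) =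
      ∑' n, b n * primeMonomial (dilatedPoint r θ) n * ((torusChar m θ)⁻¹ : Circle) := by
    rw [tsum_mul_right, (hF _ (dilatedPoint_mem r θ)).tsum_eq]
  simp only [hF']
  rw [← hsum, tsum_eq_single m]
  · have (θ : InfTorus) : b m * primeMonomial (dilatedPoint r θ) m * ((torusChar m θ)⁻¹ : Circle) =
        b m * (seqMonomial (fun j => (r : ℝ) ^ (j + 1)) m : ℝ) := by
      rw [primeMonomial_dilatedPoint, mul_assoc, mul_assoc, ← Circle.coe_mul, mul_inv_cancel,
        Circle.coe_one, mul_one]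
    simp only [this, integral_const, probReal_univ, one_smul]
  · intro n hn
    simp only [primeMonomial_dilatedPoint, mul_assoc]
    rw [integral_const_mul, integral_const_mul, integral_torusChar_mul_conj m.ne_zero n.ne_zero
      (by exact_mod_cast hn.symm), mul_zero, mul_zero]

/-- The coefficients of a function of finite Hardy norm are bounded. -/
theorem norm_coeff_le {p : ℝ} (hp : 1 ≤ p) {F : EllOne → ℂ} {b : ℕ+ → ℂ}
    (hF : HasMonomialExpansion F b) (hFp : hardyNormPow p F < ⊤) (m : ℕ+) :
    ‖b m‖ ≤ (1 + hardyNormPow p F).toReal := by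
  have hle (r : Set.Ioo (0 : ℝ) 1) : ‖b m‖ * seqMonomial (fun j => (r : ℝ) ^ (j + 1)) m ≤
      (1 + hardyNormPow p F).toReal := by
    have h0 : 0 ≤ seqMonomial (fun j => (r : ℝ) ^ (j + 1)) m :=
      seqMonomial_nonneg (fun j => pow_nonneg r.2.1.le _) m
    have h1 : ‖b m‖ₑ * ‖((seqMonomial (fun j => (r : ℝ) ^ (j + 1)) m : ℝ) : ℂ)‖ₑ ≤
        1 + hardyNormPow p F := by
      rw [← enorm_mul, ← coeff_eq_integral hF r m]
      calc _ ≤ ∫⁻ θ, ‖F (dilatedPoint r θ) * ((torusChar m θ)⁻¹ : Circle)‖ₑ ∂torusMeasure :=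
            enorm_integral_le_lintegral_enorm _
        _ ≤ ∫⁻ θ, (1 + ‖F (dilatedPoint r θ)‖ₑ ^ p) ∂torusMeasure := by
            refine lintegral_mono fun θ => ?_
            have hc : ‖(((torusChar m θ)⁻¹ : Circle) : ℂ)‖ₑ = 1 := by
              rw [← ofReal_norm, Circle.norm_coe, ENNReal.ofReal_one]
            rw [enorm_mul, hc, mul_one]
            -- The inequality `u ≤ 1 + u ^ p` replaces Hölder's; only some finite bound is needed.
            rcases le_total ‖F (dilatedPoint r θ)‖ₑ 1 with h | h
            · exact h.trans le_self_add
            · refine le_trans ?_ le_add_self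
              simpa using ENNReal.rpow_le_rpow_of_exponent_le h hp
        _ = 1 + ∫⁻ θ, ‖F (dilatedPoint r θ)‖ₑ ^ p ∂torusMeasure := by
            rw [lintegral_add_left measurable_const]
            simp
        _ ≤ _ := by
            gcongr
            exact le_iSup (fun r : Set.Ioo (0 : ℝ) 1 =>
              ∫⁻ θ, ‖F (dilatedPoint r θ)‖ₑ ^ p ∂torusMeasure) r
    have h2 := ENNReal.toReal_mono (by finiteness) h1
    simpa [abs_of_nonneg h0] using h2
  have hcont : Continuous fun r : ℝ => ‖b m‖ * seqMonomial (fun j => r ^ (j + 1)) m := by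
    unfold seqMonomial Finsupp.prod
    fun_prop
  have hlim : Filter.Tendsto (fun r : ℝ => ‖b m‖ * seqMonomial (fun j => r ^ (j + 1)) m)
      (𝓝[<] 1) (𝓝 ‖b m‖) := by
    have := (hcont.tendsto 1).mono_left (nhdsWithin_le_nhds (s := Set.Iio 1))
    simpa [seqMonomial, Finsupp.prod] using this
  refine le_of_tendsto hlim ?_
  filter_upwards [Ioo_mem_nhdsLT (zero_lt_one (α := ℝ))] with r hr using hle ⟨r, hr⟩

/-! ### Measurability of the Hardy sequence space -/

/-- The sum of the series `∑ b_n ζ^{α(n)}`. -/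
noncomputable def monomialSum (b : ℕ+ → ℂ) (ζ : EllOne) : ℂ := ∑' n, b n * primeMonomial ζ n

theorem hasMonomialExpansion_monomialSum {b : ℕ+ → ℂ} {C : ℝ} (hb : ∀ n, ‖b n‖ ≤ C) :
    HasMonomialExpansion (monomialSum b) b :=
  fun _ hζ => (summable_mul_primeMonomial hb hζ).hasSum

theorem mem_hardySequences_iff {p : ℝ} (hp : 1 ≤ p) {b : ℕ+ → ℂ} :
    b ∈ hardySequences p ↔ (∃ C : ℝ, ∀ n, ‖b n‖ ≤ C) ∧ hardyNormPow p (monomialSum b) < ⊤ := by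
  constructor
  · rintro ⟨F, ⟨-, hFp⟩, hF⟩
    refine ⟨⟨_, norm_coeff_le hp hF hFp⟩, ?_⟩
    convert hFp using 1
    unfold hardyNormPow
    congr! 6 with r θ
    exact (hF _ (dilatedPoint_mem r _)).tsum_eq
  · rintro ⟨⟨C, hC⟩, hb⟩
    have h := hasMonomialExpansion_monomialSum hC
    exact ⟨_, ⟨isAnalyticOnPolydisk_of_bounded hC h, hb⟩, h⟩

/-- Restricting to bounded sequences makes the sum a genuine pointwise limit of measurable finite
sums. Joint measurability lets the integral over `θ` be measurable in `b`. -/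
theorem measurable_monomialSum_dilatedPoint (r : Set.Ioo (0 : ℝ) 1) :
    Measurable fun x : {b : ℕ+ → ℂ // ∃ C : ℝ, ∀ n, ‖b n‖ ≤ C} × InfTorus =>
      monomialSum x.1 (dilatedPoint r x.2) := by
  refine measurable_of_tendsto_metrizable' (f := fun (s : Finset ℕ+) x =>
    ∑ n ∈ s, (x.1 : ℕ+ → ℂ) n * primeMonomial (dilatedPoint r x.2) n) Filter.atTop
    (fun s => ?_) (tendsto_pi_nhds.2 fun x => ?_)
  · refine Finset.measurable_sum _ fun n _ => Measurable.mul ?_ ?_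
    · exact (measurable_pi_apply n).comp (measurable_subtype_coe.comp measurable_fst)
    · exact (continuous_primeMonomial_dilatedPoint r n).measurable.comp measurable_snd
  · obtain ⟨C, hC⟩ := x.1.2
    exact hasMonomialExpansion_monomialSum hC _ (dilatedPoint_mem r x.2)

theorem measurable_monomialSum_dilatedPoint_right {b : ℕ+ → ℂ} {C : ℝ} (hb : ∀ n, ‖b n‖ ≤ C)
    (r : Set.Ioo (0 : ℝ) 1) : Measurable fun θ => monomialSum b (dilatedPoint r θ) :=
  (measurable_monomialSum_dilatedPoint r).comp
    (measurable_prodMk_left (x := (⟨b, C, hb⟩ : {b : ℕ+ → ℂ // ∃ C : ℝ, ∀ n, ‖b n‖ ≤ C})))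

theorem tendsto_monomialSum_dilatedPoint {b : ℕ+ → ℂ} {C : ℝ} (hb : ∀ n, ‖b n‖ ≤ C)
    {u : ℕ → Set.Ioo (0 : ℝ) 1} {r : Set.Ioo (0 : ℝ) 1}
    (hu : Filter.Tendsto u Filter.atTop (𝓝 r)) (θ : InfTorus) :
    Filter.Tendsto (fun k => monomialSum b (dilatedPoint (u k) θ)) Filter.atTop
      (𝓝 (monomialSum b (dilatedPoint r θ))) := by
  have hu' : Filter.Tendsto (fun k => (u k : ℝ)) Filter.atTop (𝓝 r) :=
    (continuous_subtype_val.tendsto r).comp hu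
  -- Eventually `u k < s`, so the series at radius `s` dominates.
  obtain ⟨s, hrs, hs1⟩ := exists_between r.2.2
  set s' : Set.Ioo (0 : ℝ) 1 := ⟨s, r.2.1.trans hrs, hs1⟩
  refine tendsto_tsum_of_dominated_convergence
    ((summable_norm_primeMonomial (dilatedPoint_mem s' θ)).mul_left C) (fun n => ?_) ?_
  · have hcont : Continuous fun t : ℝ =>
        b n * (((seqMonomial (fun j => t ^ (j + 1)) n : ℝ) : ℂ) * (torusChar n θ : ℂ)) := by
      unfold seqMonomial Finsupp.prod
      fun_prop
    simp only [primeMonomial_dilatedPoint]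
    exact (hcont.tendsto _).comp hu'
  · filter_upwards [hu'.eventually (gt_mem_nhds hrs)] with k hk n
    refine (norm_mul_primeMonomial_le hb _ n).trans ?_
    rw [norm_primeMonomial_dilatedPoint, norm_primeMonomial_dilatedPoint]
    exact mul_le_mul_of_nonneg_left (seqMonomial_mono (fun j => pow_nonneg (u k).2.1.le _)
      (fun j => pow_le_pow_left₀ (u k).2.1.le hk.le _) n) ((norm_nonneg _).trans (hb 1))

/-- The supremum in the Hardy norm may be taken over a dense sequence of radii. -/
theorem hardyNormPow_monomialSum_eq_iSup (p : ℝ) {b : ℕ+ → ℂ} {C : ℝ}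
    (hb : ∀ n, ‖b n‖ ≤ C) {D : ℕ → Set.Ioo (0 : ℝ) 1} (hD : DenseRange D) :
    hardyNormPow p (monomialSum b) =
      ⨆ k, ∫⁻ θ, ‖monomialSum b (dilatedPoint (D k) θ)‖ₑ ^ p ∂torusMeasure := by
  refine le_antisymm (iSup_le fun r => ?_) (iSup_le fun k => le_iSup
    (fun r => ∫⁻ θ, ‖monomialSum b (dilatedPoint r θ)‖ₑ ^ p ∂torusMeasure) (D k))
  obtain ⟨u, hu, hur⟩ := mem_closure_iff_seq_limit.1 (hD r)
  have hlim (θ : InfTorus) : Filter.liminf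
      (fun k => ‖monomialSum b (dilatedPoint (u k) θ)‖ₑ ^ p) Filter.atTop =
        ‖monomialSum b (dilatedPoint r θ)‖ₑ ^ p :=
    (((ENNReal.continuous_rpow_const (y := p)).comp continuous_enorm).tendsto _ |>.comp
      (tendsto_monomialSum_dilatedPoint hb hur θ)).liminf_eq
  simp only [← hlim]
  refine (lintegral_liminf_le fun k =>
    (measurable_monomialSum_dilatedPoint_right hb (u k)).enorm.pow_const p).trans ?_
  refine Filter.liminf_le_of_frequently_le' (.of_forall fun k => ?_)
  obtain ⟨i, hi⟩ := hu k
  rw [← hi]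
  exact le_iSup (fun k => ∫⁻ θ, ‖monomialSum b (dilatedPoint (D k) θ)‖ₑ ^ p ∂torusMeasure) i

theorem measurableSet_bounded : MeasurableSet {b : ℕ+ → ℂ | ∃ C : ℝ, ∀ n, ‖b n‖ ≤ C} := by
  have : {b : ℕ+ → ℂ | ∃ C : ℝ, ∀ n, ‖b n‖ ≤ C} = ⋃ k : ℕ, ⋂ n, {b : ℕ+ → ℂ | ‖b n‖ ≤ k} := by
    ext b
    simp only [Set.mem_ofPred_eq, Set.mem_iUnion, Set.mem_iInter]
    constructor
    · rintro ⟨C, hC⟩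
      obtain ⟨k, hk⟩ := exists_nat_ge C
      exact ⟨k, fun n => (hC n).trans hk⟩
    · rintro ⟨k, hk⟩
      exact ⟨k, hk⟩
  rw [this]
  exact .iUnion fun k => .iInter fun n =>
    measurableSet_le (measurable_pi_apply n).norm measurable_const

theorem measurableSet_hardySequences {p : ℝ} (hp : 1 ≤ p) : MeasurableSet (hardySequences p) := by
  have : Nonempty (Set.Ioo (0 : ℝ) 1) := ⟨⟨1 / 2, by norm_num⟩⟩
  set D := TopologicalSpace.denseSeq (Set.Ioo (0 : ℝ) 1)
  have hD : DenseRange D := TopologicalSpace.denseRange_denseSeq _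
  have heq : hardySequences p = Subtype.val '' {b : {b : ℕ+ → ℂ // ∃ C : ℝ, ∀ n, ‖b n‖ ≤ C} |
      (⨆ k, ∫⁻ θ, ‖monomialSum b (dilatedPoint (D k) θ)‖ₑ ^ p ∂torusMeasure) < ⊤} := by
    ext b
    rw [mem_hardySequences_iff hp]
    constructor
    · rintro ⟨⟨C, hC⟩, hb⟩
      refine ⟨⟨b, C, hC⟩, ?_, rfl⟩
      rwa [hardyNormPow_monomialSum_eq_iSup p hC hD] at hb
    · rintro ⟨⟨b, C, hC⟩, hb, rfl⟩
      refine ⟨⟨C, hC⟩, ?_⟩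
      rwa [hardyNormPow_monomialSum_eq_iSup p hC hD]
  rw [heq]
  refine MeasurableSet.subtype_image measurableSet_bounded
    (measurableSet_lt (.iSup fun k => ?_) measurable_const)
  exact ((measurable_monomialSum_dilatedPoint (D k)).enorm.pow_const p).lintegral_prod_right'

/-! ### Linear structure of the Hardy sequence space -/

theorem add_mem_hardySequences {p : ℝ} (hp : 1 ≤ p) {b c : ℕ+ → ℂ} (hb : b ∈ hardySequences p)
    (hc : c ∈ hardySequences p) : b + c ∈ hardySequences p := by
  obtain ⟨⟨B, hB⟩, hb⟩ := (mem_hardySequences_iff hp).1 hb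
  obtain ⟨⟨C, hC⟩, hc⟩ := (mem_hardySequences_iff hp).1 hc
  refine (mem_hardySequences_iff hp).2 ⟨⟨B + C, fun n => norm_add_le_of_le (hB n) (hC n)⟩, ?_⟩
  have hle : hardyNormPow p (monomialSum (b + c)) ≤
      2 ^ (p - 1) * (hardyNormPow p (monomialSum b) + hardyNormPow p (monomialSum c)) := by
    refine iSup_le fun r => ?_
    have hadd (θ : InfTorus) : monomialSum (b + c) (dilatedPoint r θ) =
        monomialSum b (dilatedPoint r θ) + monomialSum c (dilatedPoint r θ) := by
      unfold monomialSum
      rw [← (summable_mul_primeMonomial hB (dilatedPoint_mem r θ)).tsum_add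
        (summable_mul_primeMonomial hC (dilatedPoint_mem r θ))]
      simp [add_mul]
    calc _ ≤ ∫⁻ θ, 2 ^ (p - 1) * (‖monomialSum b (dilatedPoint r θ)‖ₑ ^ p +
            ‖monomialSum c (dilatedPoint r θ)‖ₑ ^ p) ∂torusMeasure := by
          refine lintegral_mono fun θ => ?_
          rw [hadd]
          exact (ENNReal.rpow_le_rpow (enorm_add_le _ _) (by linarith)).trans
            (ENNReal.rpow_add_le_mul_rpow_add_rpow _ _ hp)
      _ = 2 ^ (p - 1) * (∫⁻ θ, ‖monomialSum b (dilatedPoint r θ)‖ₑ ^ p ∂torusMeasure +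
            ∫⁻ θ, ‖monomialSum c (dilatedPoint r θ)‖ₑ ^ p ∂torusMeasure) := by
          rw [lintegral_const_mul', lintegral_add_left]
          · exact (measurable_monomialSum_dilatedPoint_right hB r).enorm.pow_const p
          · exact ENNReal.rpow_ne_top_of_nonneg (by linarith) (by simp)
      _ ≤ _ := by
          gcongr
          · exact le_iSup (fun r =>
              ∫⁻ θ, ‖monomialSum b (dilatedPoint r θ)‖ₑ ^ p ∂torusMeasure) r
          · exact le_iSup (fun r =>
              ∫⁻ θ, ‖monomialSum c (dilatedPoint r θ)‖ₑ ^ p ∂torusMeasure) r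
  refine hle.trans_lt (ENNReal.mul_lt_top ?_ (ENNReal.add_lt_top.2 ⟨hb, hc⟩))
  exact (ENNReal.rpow_ne_top_of_nonneg (by linarith) (by simp)).lt_top

theorem smul_mem_hardySequences {p : ℝ} (hp : 1 ≤ p) (t : ℂ) {b : ℕ+ → ℂ}
    (hb : b ∈ hardySequences p) : t • b ∈ hardySequences p := by
  obtain ⟨⟨B, hB⟩, hb⟩ := (mem_hardySequences_iff hp).1 hb
  refine (mem_hardySequences_iff hp).2 ⟨⟨‖t‖ * B, fun n => ?_⟩, ?_⟩
  · rw [Pi.smul_apply, norm_smul]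
    exact mul_le_mul_of_nonneg_left (hB n) (norm_nonneg t)
  have ht : ‖t‖ₑ ^ p ≠ ⊤ := ENNReal.rpow_ne_top_of_nonneg (by linarith) (by simp)
  have heq : hardyNormPow p (monomialSum (t • b)) = ‖t‖ₑ ^ p * hardyNormPow p (monomialSum b) := by
    unfold hardyNormPow
    rw [ENNReal.mul_iSup]
    refine iSup_congr fun r => ?_
    rw [← lintegral_const_mul' _ _ ht]
    refine lintegral_congr fun θ => ?_
    rw [← ENNReal.mul_rpow_of_nonneg _ _ (by linarith), ← enorm_mul]
    congr 2
    unfold monomialSum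
    rw [← tsum_mul_left]
    simp [mul_assoc]
  rw [heq]
  exact ENNReal.mul_lt_top ht.lt_top hb

/-! ### Reflection of Gaussian laws -/

/-- A Gaussian measure is symmetric about its mean. -/
theorem map_reflection_eq_self {E : Type*} [NormedAddCommGroup E] [NormedSpace ℝ E]
    [SecondCountableTopology E] [CompleteSpace E] [MeasurableSpace E] [BorelSpace E]
    (γ : Measure E) [IsGaussian γ] {m : E} (hm : ∫ x, x ∂γ = m) :
    γ.map (fun x => (2 : ℝ) • m - x) = γ := by
  have hid : Integrable (fun x : E => x) γ := IsGaussian.integrable_id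
  have hL (L : StrongDual ℝ E) : ∫ x, L x ∂γ = L m := by
    rw [← hm]; exact L.integral_comp_comm hid
  -- A Gaussian characteristic function depends only on the mean and variance of each `L`, and the
  -- reflection preserves both.
  apply Measure.ext_of_charFunDual
  ext L
  rw [IsGaussian.charFunDual_eq, IsGaussian.charFunDual_eq, integral_complex_ofReal,
    integral_complex_ofReal, integral_map (by fun_prop) (by fun_prop),
    variance_map (by fun_prop) (by fun_prop), hL]
  have h1 : ∫ x, L ((2 : ℝ) • m - x) ∂γ = L m := by
    simp only [map_sub, map_smul, smul_eq_mul]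
    rw [integral_sub (integrable_const _) (IsGaussian.integrable_dual γ L), hL]
    simp
    ring
  have h2 : Var[(fun x => L x) ∘ fun x => (2 : ℝ) • m - x; γ] = Var[fun x => L x; γ] := by
    have : (fun x => L x) ∘ (fun x => (2 : ℝ) • m - x) = fun x => L ((2 : ℝ) • m) - L x := by
      ext x; simp
    rw [this, variance_const_sub (by fun_prop)]
  rw [h1, h2]

/-- A Gaussian process has the same law as its reflection about its mean. -/
theorem map_reflection_process_eq {Ω T : Type*} [Countable T] [MeasurableSpace Ω] {P : Measure Ω}
    [IsProbabilityMeasure P] {X : T → Ω → ℝ} (hX : IsGaussianProcess X P) {μ : T → ℝ}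
    (hμ : ∀ t, ∫ ω, X t ω ∂P = μ t) :
    P.map (fun ω t => 2 * μ t - X t ω) = P.map (fun ω t => X t ω) := by
  have hm (t : T) : AEMeasurable (X t) P := hX.aemeasurable t
  refine (map_eq_iff_forall_finset_map_restrict_eq (X := fun t ω => 2 * μ t - X t ω) (Y := X)
    (aemeasurable_pi_lambda _ fun t => (hm t).const_sub _) (aemeasurable_pi_lambda _ hm)).2
    fun I => ?_
  have hI : AEMeasurable (fun ω => I.restrict (X · ω)) P :=
    aemeasurable_pi_lambda _ fun t => hm t
  have := (hX.hasGaussianLaw I).isGaussian_map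
  have hmean : ∫ x, x ∂(P.map fun ω => I.restrict (X · ω)) = I.restrict μ := by
    ext t
    have hid : Integrable (fun x : I → ℝ => x) (P.map fun ω => I.restrict (X · ω)) :=
      IsGaussian.integrable_id
    rw [eval_integral fun t => hid.eval t, integral_map hI (measurable_pi_apply t).aestronglyMeasurable]
    exact hμ t
  conv_rhs => rw [← map_reflection_eq_self _ hmean]
  rw [AEMeasurable.map_map_of_aemeasurable (by fun_prop) hI]
  rfl

/-! ### The equivalence -/

theorem proposition3p5 {Ω : Type*} [MeasurableSpace Ω] (P : Measure Ω) [IsProbabilityMeasure P]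
    (p : ℝ) (hp : 1 ≤ p) (X : ℕ+ → Ω → ℝ) (hX : IsGaussianProcess X P)
    (μ : ℕ+ → ℝ) (σ : ℕ+ → ℝ≥0)
    (hlaw : ∀ n, HasLaw (X n) (gaussianReal (μ n) (σ n ^ 2)) P) :
    RandomizationMapsInto P X p ↔
      ((fun n => (μ n : ℂ)) ∈ coefficientMultipliers (hardySequences 2) (hardySequences p) ∧
        RandomizationMapsInto P (fun n ω => X n ω - μ n) p) := by
  constructor
  · intro h
    have hlaw' : P.map (fun ω n => 2 * μ n - X n ω) = P.map (fun ω n => X n ω) :=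
      map_reflection_process_eq hX fun n => by rw [(hlaw n).integral_eq, integral_id_gaussianReal]
    have hmul : (fun n => (μ n : ℂ)) ∈
        coefficientMultipliers (hardySequences 2) (hardySequences p) := by
      rintro a ⟨F, hF, hFa⟩
      have hm (n : ℕ+) : AEMeasurable (X n) P := hX.aemeasurable n
      have hmeas : MeasurableSet {x : ℕ+ → ℝ | (fun n => a n * (x n : ℂ)) ∈ hardySequences p} :=
        (measurable_pi_lambda _ fun n => by fun_prop) (measurableSet_hardySequences hp)
      have h1 := h F hF a hFa
      have h2 := (ae_map_iff (aemeasurable_pi_lambda (fun ω n => X n ω) hm) hmeas).2 h1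
      rw [← hlaw', ae_map_iff (aemeasurable_pi_lambda _ fun n => (hm n).const_sub _) hmeas] at h2
      -- One outcome suffices, since the average of the two sequences is deterministic.
      obtain ⟨ω, hω1, hω2⟩ := (h1.and h2).exists
      convert smul_mem_hardySequences hp (1 / 2) (add_mem_hardySequences hp hω1 hω2) using 1
      ext n
      simp only [Pi.smul_apply, Pi.add_apply, smul_eq_mul]
      push_cast
      ring
    refine ⟨hmul, fun F hF a hFa => ?_⟩
    filter_upwards [h F hF a hFa] with ω hω
    convert add_mem_hardySequences hp hω
      (smul_mem_hardySequences hp (-1) (hmul a ⟨F, hF, hFa⟩)) using 1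
    ext n
    simp only [Pi.smul_apply, Pi.add_apply, smul_eq_mul]
    push_cast
    ring
  · rintro ⟨hmul, hY⟩ F hF a hFa
    filter_upwards [hY F hF a hFa] with ω hω
    convert add_mem_hardySequences hp hω (hmul a ⟨F, hF, hFa⟩) using 1
    ext n
    simp only [Pi.add_apply]
    push_cast
    ring
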